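/- Let $n\ge 0$, let $(\tilde M,\tilde g)$ be a smooth Riemannian manifold (without boundary) of dimension $n+1$, equipped with an orientation, and let $dV_{\tilde g}$ be its Riemannian volume form. Let $M$ be a smooth hypersurface in $\tilde M$, i.e. a smooth $n$-dimensional manifold without boundary together with a smooth embedding $\iota\colon M\to\tilde M$, and let $g=\iota^*\tilde g$ be the induced metric. A continuous unit normal field along $M$ is a continuous map $N\colon M\to T\tilde M$ with $N(p)\in T_{\iota(p)}\tilde M$, $N(p)\perp d\iota_p(T_pM)$ and $\tilde g(N(p),N(p))=1$ for all $p\in M$. For such $N$ let $(N\lrcorner\, dV_{\tilde g})|_M$ denote the $n$-form $(w_1,\dots,w_n)\mapsto dV_{\tilde g}(N(p),d\iota_p w_1,\dots,d\iota_p w_n)$ on $M$. An orientation of a manifold is a continuous choice of orientation of its tangent spaces (a choice of sign at each point in dimension $0$), and a manifold is orientable if it has one; the Riemannian volume form of an oriented Riemannian manifold is the top-degree form that takes the value $1$ on positively oriented orthonormal bases (the function $\pm1$ given by the signs in dimension $0$). Then $M$ is orientable if and only if there exists a global continuous unit normal field $N$ along $M$. In that case the volume form of $(M,g)$ is $$dV_g=(N\lrcorner\,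 dV_{\tilde g})|_M ,$$ in the following sense: for every continuous unit normal field $N$ there is exactly one orientation of $M$ whose Riemannian volume form $dV_g$ satisfies this equation, and for every orientation of $M$ there is exactly one continuous unit normal field $N$ for which the equation holds. -/

import Mathlib

open scoped Manifold ContDiff Bundle Topology

noncomputable section

/-- An orientation of an `n`-dimensional smooth manifold `M`: a choice of orientation of every
tangent space which is continuous, i.e. locally constant when it is read in the coordinates given by
the preferred chart at any point. (In dimension `0` this is a choice of a sign at each point.) -/
@[ext]
structure ManifoldOrientation (n : ℕ) (M : Type*) [TopologicalSpace M]
    [ChartedSpace (EuclideanSpace ℝ (Fin n)) M] [IsManifold (𝓡 n) ∞ M] where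
  /-- the orientation of the tangent space at `p` -/
  at_ (p : M) : Orientation ℝ (TangentSpace (𝓡 n) p) (Fin n)
  continuous' (p : M) : ∃ o : Orientation ℝ (EuclideanSpace ℝ (Fin n)) (Fin n),
    ∀ᶠ q in 𝓝 p, ∀ hq : q ∈ (trivializationAt (EuclideanSpace ℝ (Fin n))
        (TangentSpace (𝓡 n) : M → Type _) p).baseSet,
      Orientation.map (Fin n) ((trivializationAt (EuclideanSpace ℝ (Fin n))
        (TangentSpace (𝓡 n) : M → Type _) p).linearEquivAt ℝ q hq) (at_ q) = o

/-- `M` is orientable if it admits an orientation. -/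
def IsOrientable (n : ℕ) (M : Type*) [TopologicalSpace M]
    [ChartedSpace (EuclideanSpace ℝ (Fin n)) M] [IsManifold (𝓡 n) ∞ M] : Prop :=
  Nonempty (ManifoldOrientation n M)

/-- The volume form of the oriented Riemannian manifold `(M, g, O)`, as a section `p ↦ (dV_g)_p` of
the bundle of alternating `n`-forms: the form taking the value `1` on positively oriented
`g`-orthonormal bases. -/
def riemannianVolumeForm {n : ℕ} {M : Type*} [TopologicalSpace M]
    [ChartedSpace (EuclideanSpace ℝ (Fin n)) M] [IsManifold (𝓡 n) ∞ M]
    (g : Bundle.RiemannianMetric (TangentSpace (𝓡 n) : M → Type _))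
    (O : ManifoldOrientation n M) (p : M) :
    TangentSpace (𝓡 n) p [⋀^Fin n]→ₗ[ℝ] ℝ :=
  letI : Bundle.RiemannianBundle (TangentSpace (𝓡 n) : M → Type _) := ⟨g⟩
  haveI : Fact (Module.finrank ℝ (TangentSpace (𝓡 n) p) = n) :=
    ⟨finrank_euclideanSpace_fin (𝕜 := ℝ) (n := n)⟩
  (O.at_ p).volumeForm

section Hypersurface

variable {n : ℕ}
  {M : Type*} [TopologicalSpace M] [ChartedSpace (EuclideanSpace ℝ (Fin n)) M]
  {M' : Type*} [TopologicalSpace M'] [ChartedSpace (EuclideanSpace ℝ (Fin (n + 1))) M']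

/-- The differential of a smooth embedding is injective. -/
lemma mfderiv_injective_of_isSmoothEmbedding {ι : M → M'}
    (hι : Manifold.IsSmoothEmbedding (𝓡 n) (𝓡 (n + 1)) ∞ ι) (p : M) :
    Function.Injective (mfderiv (𝓡 n) (𝓡 (n + 1)) ι p) := by
  have h := hι.isImmersion.isImmersionAt p
  -- a smooth local left inverse of `ι` near `p`
  let r : M' → M := fun y ↦ (h.domChart.extend (𝓡 n)).symm
    (h.equiv.symm (h.codChart.extend (𝓡 (n + 1)) y)).1
  have hp := h.mem_domChart_source
  have hip := h.mem_codChart_source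
  have key : ∀ q ∈ h.domChart.source, (h.equiv.symm (h.codChart.extend (𝓡 (n + 1)) (ι q))).1 =
      h.domChart.extend (𝓡 n) q := by
    intro q hq
    have hq' : q ∈ (h.domChart.extend (𝓡 n)).source := by simpa using hq
    have h1 := h.writtenInCharts ((h.domChart.extend (𝓡 n)).map_source hq')
    simp only [Function.comp_apply, (h.domChart.extend (𝓡 n)).left_inv hq'] at h1
    rw [h1, ContinuousLinearEquiv.symm_apply_apply]
  have hleft : ∀ q ∈ h.domChart.source, r (ι q) = q := by
    intro q hq
    have hq' : q ∈ (h.domChart.extend (𝓡 n)).source := by simpa using hq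
    simp only [r, key q hq]
    exact (h.domChart.extend (𝓡 n)).left_inv hq'
  have hcod : ContMDiffAt (𝓡 (n + 1)) 𝓘(ℝ, EuclideanSpace ℝ (Fin (n + 1))) ∞
      (h.codChart.extend (𝓡 (n + 1))) (ι p) :=
    OpenPartialHomeomorph.contMDiffAt_extend h.codChart_mem_maximalAtlas hip
  have hlin : ContMDiff 𝓘(ℝ, EuclideanSpace ℝ (Fin (n + 1))) 𝓘(ℝ, EuclideanSpace ℝ (Fin n)) ∞
      (fun z ↦ (h.equiv.symm z).1) :=
    (contDiff_fst.comp h.equiv.symm.contDiff).contMDiff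
  have hsymm : ContMDiffAt 𝓘(ℝ, EuclideanSpace ℝ (Fin n)) (𝓡 n) ∞
      (h.domChart.extend (𝓡 n)).symm (h.domChart.extend (𝓡 n) p) := by
    refine (contMDiffOn_extend_symm h.domChart_mem_maximalAtlas).contMDiffAt ?_
    have := h.domChart.open_target.mem_nhds (h.domChart.map_source hp)
    simpa using this
  have hr : ContMDiffAt (𝓡 (n + 1)) (𝓡 n) ∞ r (ι p) := by
    have h2 : ContMDiffAt (𝓡 (n + 1)) 𝓘(ℝ, EuclideanSpace ℝ (Fin n)) ∞
        (fun y ↦ (h.equiv.symm (h.codChart.extend (𝓡 (n + 1)) y)).1) (ι p) :=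
      hlin.contMDiffAt.comp (ι p) hcod
    refine ContMDiffAt.comp (ι p) (g := (h.domChart.extend (𝓡 n)).symm) ?_ h2
    rw [key p hp]
    exact hsymm
  have hι' : MDifferentiableAt (𝓡 n) (𝓡 (n + 1)) ι p :=
    hι.contMDiff.contMDiffAt.mdifferentiableAt (by simp)
  have hid : mfderiv (𝓡 n) (𝓡 n) (r ∘ ι) p = ContinuousLinearMap.id ℝ _ := by
    rw [← mfderiv_id]
    apply Filter.EventuallyEq.mfderiv_eq
    filter_upwards [h.domChart.open_source.mem_nhds hp] with q hq
    exact hleft q hq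
  rw [mfderiv_comp p (hr.mdifferentiableAt (by simp)) hι'] at hid
  intro v w hvw
  have h3 := DFunLike.congr_fun hid v
  have h4 := DFunLike.congr_fun hid w
  simp only [ContinuousLinearMap.comp_apply, hvw] at h3 h4
  exact h3.symm.trans h4

variable [IsManifold (𝓡 n) ∞ M] [IsManifold (𝓡 (n + 1)) ∞ M']

/-- The metric `ι^* g'` induced on `M` by a smooth embedding `ι : M → M'`:
`(ι^* g')_p (v, w) = g'_{ι p} (dι_p v, dι_p w)`. Only the family of inner products on the tangent
spaces is recorded, since the volume form at a point depends on nothing else. -/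
def inducedMetric (g' : Bundle.ContMDiffRiemannianMetric (𝓡 (n + 1)) ∞
      (EuclideanSpace ℝ (Fin (n + 1))) (TangentSpace (𝓡 (n + 1)) : M' → Type _))
    {ι : M → M'} (hι : Manifold.IsSmoothEmbedding (𝓡 n) (𝓡 (n + 1)) ∞ ι) :
    Bundle.RiemannianMetric (TangentSpace (𝓡 n) : M → Type _) where
  inner p := (ContinuousLinearMap.precomp ℝ (mfderiv (𝓡 n) (𝓡 (n + 1)) ι p)).comp
    ((g'.inner (ι p)).comp (mfderiv (𝓡 n) (𝓡 (n + 1)) ι p))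
  symm p v w := g'.symm (ι p) _ _
  pos p v hv := g'.pos (ι p) _ fun h ↦
    hv (mfderiv_injective_of_isSmoothEmbedding hι p (h.trans (map_zero _).symm))
  continuousAt p := by
    have h1 := g'.toRiemannianMetric.continuousAt (ι p)
    rw [← map_zero (mfderiv (𝓡 n) (𝓡 (n + 1)) ι p)] at h1
    exact ContinuousAt.comp (g := fun v ↦ g'.toRiemannianMetric.inner (ι p) v v) h1
      (mfderiv (𝓡 n) (𝓡 (n + 1)) ι p).continuous.continuousAt
  isVonNBounded p := by
    let A : EuclideanSpace ℝ (Fin n) →L[ℝ] EuclideanSpace ℝ (Fin (n + 1)) :=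
      mfderiv (𝓡 n) (𝓡 (n + 1)) ι p
    have hA : Function.Injective A := mfderiv_injective_of_isSmoothEmbedding hι p
    obtain ⟨K, -, hK⟩ := A.toLinearMap.injective_iff_antilipschitz.1 hA
    have hb : Bornology.IsBounded
        {v : EuclideanSpace ℝ (Fin (n + 1)) | g'.inner (ι p) v v < 1} :=
      NormedSpace.isVonNBounded_iff ℝ |>.1 (g'.isVonNBounded (ι p))
    exact NormedSpace.isVonNBounded_iff ℝ |>.2 (hK.isBounded_preimage hb)

/-- `N` is a (global) continuous unit normal vector field along the hypersurface `ι : M → M'`: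
`N p ∈ T_{ι p} M'` is orthogonal to `dι (T_p M)`, has length `1`, and depends continuously
on `p`. -/
structure IsContinuousUnitNormal (g' : Bundle.ContMDiffRiemannianMetric (𝓡 (n + 1)) ∞
      (EuclideanSpace ℝ (Fin (n + 1))) (TangentSpace (𝓡 (n + 1)) : M' → Type _))
    (ι : M → M') (N : ∀ p : M, TangentSpace (𝓡 (n + 1)) (ι p)) : Prop where
  normal (p : M) (v : TangentSpace (𝓡 n) p) :
    g'.inner (ι p) (N p) (mfderiv (𝓡 n) (𝓡 (n + 1)) ι p v) = 0
  unit (p : M) : g'.inner (ι p) (N p) (N p) = 1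
  continuous : Continuous fun p : M ↦ (⟨ι p, N p⟩ : TangentBundle (𝓡 (n + 1)) M')

/-- `(N ⌟ η)|_M` for an `(n + 1)`-form `η` on `M'` and a vector field `N` along `ι : M → M'`:
`(w₁, …, wₙ) ↦ η (N, dι w₁, …, dι wₙ)`. -/
def interiorRestrict (ι : M → M') (N : ∀ p : M, TangentSpace (𝓡 (n + 1)) (ι p))
    (η : ∀ q : M', TangentSpace (𝓡 (n + 1)) q [⋀^Fin (n + 1)]→ₗ[ℝ] ℝ) (p : M) :
    TangentSpace (𝓡 n) p [⋀^Fin n]→ₗ[ℝ] ℝ :=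
  ((η (ι p)).curryLeft (N p)).compLinearMap (mfderiv (𝓡 n) (𝓡 (n + 1)) ι p).toLinearMap

end Hypersurface

end

/-!
The form `(N ⌟ dV_g')|_M` takes one of the values `±1` on every orthonormal basis of a tangent space
of `M`, because such a basis together with `N` is an orthonormal basis of the tangent space of `M'`.
Hence at each point a unit normal vector induces exactly one orientation
(`existsUnique_orientation_of_normal`), and since the two unit normal vectors are opposite to each
other, an orientation is induced by exactly one of them (`existsUnique_normal_of_orientation`). All
uniqueness claims are therefore pointwise, and existence reduces to continuity.

Continuity is a matter of signs in coordinates. Orientations `o_q` of the tangent spaces are locally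
constant near `p` if and only if their volume forms have locally constant sign on the coordinate
frame (`locallyConstant_orientation_iff_hasConstantSignNear`). If `o_q` and `N q` correspond to each
other, the value of the volume form of `o_q` on the coordinate frame `e` is that of `dV_g'` on the
coordinate frame of `M'`, whose sign is locally constant because `M'` is oriented, times the
determinant of `(N, dι e₁, …, dι eₙ)` in coordinates. So the orientations `o_q` are locally constant
if and only if this determinant has locally constant sign (`hasConstantSignNear_iff_normalDet`).

If `N` is continuous, so is the nowhere vanishing determinant, and its sign is locally constant.
Conversely, let `G` be the metric in coordinates and `α` the linear form
`v ↦ det (v, dι e₁, …, dι eₙ)`. Both `G N` and `α` vanish on the tangent space of `M`, so `N` is the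
normalization of `± G⁻¹ α`, with the sign of the determinant. If that sign is locally constant, then
`N` is continuous (`continuousAt_unitNormal`).
-/

/-! ### Volume forms and unit normals of a hyperplane -/

section LinearAlgebra

variable {n : ℕ} {V V' : Type*} [NormedAddCommGroup V] [InnerProductSpace ℝ V]
  [NormedAddCommGroup V'] [InnerProductSpace ℝ V']
  [Fact (Module.finrank ℝ V = n)] [Fact (Module.finrank ℝ V' = n + 1)]

lemma exists_orthonormalBasis_fin (V : Type*) [NormedAddCommGroup V] [InnerProductSpace ℝ V]
    [FiniteDimensional ℝ V] [hV : Fact (Module.finrank ℝ V = n)] :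
    Nonempty (OrthonormalBasis (Fin n) ℝ V) :=
  ⟨(stdOrthonormalBasis ℝ V).reindex (finCongr hV.out)⟩

lemma volumeForm_basis_pos_iff [FiniteDimensional ℝ V] (o : Orientation ℝ V (Fin n))
    (b : Module.Basis (Fin n) ℝ V) : 0 < o.volumeForm b ↔ b.orientation = o := by
  obtain ⟨f⟩ := exists_orthonormalBasis_fin (n := n) V
  by_cases h : f.toBasis.orientation = o
  · rw [o.volumeForm_robust f h, ← f.toBasis.orientation_eq_iff_det_pos b, h, eq_comm]
  · have ho : o = -f.toBasis.orientation := (f.toBasis.orientation_ne_iff_eq_neg o).1 (Ne.symm h)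
    have hne : f.toBasis.det b ≠ 0 := (f.toBasis.isUnit_det b).ne_zero
    have hneg : 0 < -f.toBasis.det b ↔ ¬ 0 < f.toBasis.det b := by
      rw [not_lt, neg_pos]
      exact ⟨le_of_lt, fun h ↦ lt_of_le_of_ne h hne⟩
    rw [o.volumeForm_robust_neg f h, AlternatingMap.neg_apply, hneg,
      ← f.toBasis.orientation_eq_iff_det_pos b, ho, ← f.toBasis.orientation_ne_iff_eq_neg, ne_comm]

lemma volumeForm_basis_ne_zero [FiniteDimensional ℝ V] (o : Orientation ℝ V (Fin n))
    (b : Module.Basis (Fin n) ℝ V) : o.volumeForm b ≠ 0 := by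
  obtain ⟨f⟩ := exists_orthonormalBasis_fin (n := n) V
  rw [← abs_ne_zero, o.volumeForm_robust' f, abs_ne_zero]
  exact (f.toBasis.isUnit_det b).ne_zero

/-- Opposite orientations have opposite volume forms, and these do not vanish. -/
lemma volumeForm_injective [FiniteDimensional ℝ V] :
    Function.Injective (Orientation.volumeForm : Orientation ℝ V (Fin n) → _) := by
  intro o₁ o₂ h
  obtain ⟨f⟩ := exists_orthonormalBasis_fin (n := n) V
  have hcard : Fintype.card (Fin n) = Module.finrank ℝ V := by
    rw [Fintype.card_fin, Fact.out (p := Module.finrank ℝ V = n)]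
  rcases o₁.eq_or_eq_neg o₂ hcard with h3 | h3
  · exact h3
  · have := o₂.volumeForm_neg_orientation
    rw [← h3, h] at this
    exact absurd (self_eq_neg.1 (congrArg (fun η ↦ η f.toBasis) this))
      (volumeForm_basis_ne_zero o₂ f.toBasis)

omit [Fact (Module.finrank ℝ V = n)] in
/-- An orthonormal basis of a hyperplane, preceded by a unit normal vector, is an orthonormal
basis of the whole space. -/
lemma exists_orthonormalBasis_cons (A : V →ₗᵢ[ℝ] V') {N : V'} (hN : ‖N‖ = 1)
    (hNA : ∀ v, inner ℝ N (A v) = 0) (e : OrthonormalBasis (Fin n) ℝ V) :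
    ∃ b : OrthonormalBasis (Fin (n + 1)) ℝ V', ⇑b = Fin.cons N (A ∘ e) := by
  have hV' : Module.finrank ℝ V' = n + 1 := Fact.out
  have hon : Orthonormal ℝ (Fin.cons N (A ∘ e) : Fin (n + 1) → V') := by
    constructor
    · intro i
      refine Fin.cases ?_ (fun j ↦ ?_) i
      · simpa using hN
      · simp
    · intro i j hij
      induction i using Fin.cases with
      | zero =>
        induction j using Fin.cases with
        | zero => exact absurd rfl hij
        | succ j => simpa using hNA (e j)
      | succ i =>
        induction j using Fin.cases with
        | zero => simpa [real_inner_comm] using hNA (e i)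
        | succ j =>
          have : i ≠ j := fun h ↦ hij (congrArg _ h)
          simpa using e.orthonormal.2 this
  have hcard : Fintype.card (Fin (n + 1)) = Module.finrank ℝ V' := by simp [hV']
  exact ⟨(basisOfOrthonormalOfCardEqFinrank hon hcard).toOrthonormalBasis (by simpa using hon),
    by simp⟩

omit [Fact (Module.finrank ℝ V = n)] in
/-- The restriction of `N ⌟ dV'` to a hyperplane, for a unit normal vector `N`, takes one of the
values `±1` on an orthonormal basis. -/
lemma abs_volumeForm_cons (A : V →ₗᵢ[ℝ] V') {N : V'} (hN : ‖N‖ = 1)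
    (hNA : ∀ v, inner ℝ N (A v) = 0) (o' : Orientation ℝ V' (Fin (n + 1)))
    (e : OrthonormalBasis (Fin n) ℝ V) :
    |o'.volumeForm (Fin.cons N (A ∘ e))| = 1 := by
  obtain ⟨b, hb⟩ := exists_orthonormalBasis_cons A hN hNA e
  rw [← hb, o'.abs_volumeForm_apply_of_orthonormal]

lemma volumeForm_eq_iff_apply_orthonormalBasis (A : V →ₗᵢ[ℝ] V') (N : V')
    (o : Orientation ℝ V (Fin n)) (o' : Orientation ℝ V' (Fin (n + 1)))
    (e : OrthonormalBasis (Fin n) ℝ V) :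
    o.volumeForm = (o'.volumeForm.curryLeft N).compLinearMap A.toLinearMap ↔
      o.volumeForm e = o'.volumeForm (Fin.cons N (A ∘ e)) := by
  constructor
  · intro h
    rw [h]
    rfl
  · intro h
    rw [o.volumeForm.eq_smul_basis_det e.toBasis,
      ((o'.volumeForm.curryLeft N).compLinearMap A.toLinearMap).eq_smul_basis_det e.toBasis]
    exact congrArg (· • e.toBasis.det) (by simpa only [OrthonormalBasis.coe_toBasis] using! h)

/-- A unit normal vector to a hyperplane induces exactly one orientation of it. -/
lemma existsUnique_orientation_of_normal [FiniteDimensional ℝ V]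
    (A : V →ₗᵢ[ℝ] V') {N : V'} (hN : ‖N‖ = 1)
    (hNA : ∀ v, inner ℝ N (A v) = 0) (o' : Orientation ℝ V' (Fin (n + 1))) :
    ∃! o : Orientation ℝ V (Fin n),
      o.volumeForm = (o'.volumeForm.curryLeft N).compLinearMap A.toLinearMap := by
  obtain ⟨e⟩ := exists_orthonormalBasis_fin (n := n) V
  refine existsUnique_of_exists_of_unique ?_ fun o₁ o₂ h₁ h₂ ↦
    volumeForm_injective (h₁.trans h₂.symm)
  have hpos : e.toBasis.orientation.volumeForm e = 1 := by
    rw [e.toBasis.orientation.volumeForm_robust e rfl]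
    simpa using e.toBasis.det_self
  rcases abs_eq (zero_le_one' ℝ) |>.1 (abs_volumeForm_cons A hN hNA o' e) with h | h
  · exact ⟨e.toBasis.orientation, (volumeForm_eq_iff_apply_orthonormalBasis A N _ o' e).2
      (hpos.trans h.symm)⟩
  · refine ⟨-e.toBasis.orientation, (volumeForm_eq_iff_apply_orthonormalBasis A N _ o' e).2 ?_⟩
    rw [Orientation.volumeForm_neg_orientation, AlternatingMap.neg_apply, hpos, h]

/-- An orientation of a hyperplane is induced by exactly one of its two unit normal vectors. -/
lemma existsUnique_normal_of_orientation [FiniteDimensional ℝ V] [FiniteDimensional ℝ V']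
    (A : V →ₗᵢ[ℝ] V') (o : Orientation ℝ V (Fin n)) (o' : Orientation ℝ V' (Fin (n + 1))) :
    ∃! N : V', ((∀ v, inner ℝ N (A v) = 0) ∧ ‖N‖ = 1) ∧
      o.volumeForm = (o'.volumeForm.curryLeft N).compLinearMap A.toLinearMap := by
  obtain ⟨e⟩ := exists_orthonormalBasis_fin (n := n) V
  have ho := o.abs_volumeForm_apply_of_orthonormal e
  simp only [volumeForm_eq_iff_apply_orthonormalBasis A _ o o' e]
  refine existsUnique_of_exists_of_unique ?_ ?_
  · obtain ⟨u, hu⟩ : ∃ u : V', u ∈ (LinearMap.range A.toLinearMap)ᗮ ∧ u ≠ 0 := by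
      refine Submodule.exists_mem_ne_zero_of_ne_bot fun hbot ↦ ?_
      have h₁ := Submodule.finrank_add_finrank_orthogonal (LinearMap.range A.toLinearMap)
      rw [hbot, finrank_bot, LinearMap.finrank_range_of_inj A.injective,
        Fact.out (p := Module.finrank ℝ V = n), Fact.out (p := Module.finrank ℝ V' = n + 1)] at h₁
      omega
    have hu' : ‖u‖ ≠ 0 := norm_ne_zero_iff.2 hu.2
    have hN : ‖‖u‖⁻¹ • u‖ = 1 := by rw [norm_smul, norm_inv, norm_norm, inv_mul_cancel₀ hu']
    have hNA : ∀ v, inner ℝ (‖u‖⁻¹ • u) (A v) = 0 := fun v ↦ by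
      have huv : inner ℝ u (A v) = 0 :=
        (Submodule.mem_orthogonal' _ u).1 hu.1 _ (LinearMap.mem_range_self A.toLinearMap v)
      rw [real_inner_smul_left, huv, mul_zero]
    have hω := abs_volumeForm_cons A hN hNA o' e
    rcases abs_eq_abs.1 (ho.trans hω.symm) with h | h
    · exact ⟨_, ⟨hNA, hN⟩, h⟩
    · refine ⟨-(‖u‖⁻¹ • u), ⟨fun v ↦ ?_, ?_⟩, ?_⟩
      · rw [inner_neg_left, hNA, neg_zero]
      · rw [norm_neg, hN]
      · rw [h]
        have := o'.volumeForm.curryLeft.map_neg (‖u‖⁻¹ • u)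
        exact (congrArg (fun η ↦ η (A ∘ e)) this).symm
  · rintro N₁ N₂ ⟨⟨hA₁, hN₁⟩, h₁⟩ ⟨⟨hA₂, hN₂⟩, h₂⟩
    -- Expand `N₂` in the orthonormal basis `(N₁, A e)`: it is the multiple `⟪N₁, N₂⟫ • N₁`.
    obtain ⟨b, hb⟩ := exists_orthonormalBasis_cons A hN₁ hA₁ e
    have hexp : N₂ = inner ℝ N₁ N₂ • N₁ := by
      have := b.sum_repr' N₂
      rw [Fin.sum_univ_succ, hb] at this
      simp only [Fin.cons_zero, Fin.cons_succ, Function.comp_apply] at this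
      rw [Finset.sum_eq_zero (fun i _ ↦ by rw [real_inner_comm, hA₂, zero_smul]),
        add_zero] at this
      exact this.symm
    have hval : o'.volumeForm (Fin.cons N₂ (A ∘ e)) =
        inner ℝ N₁ N₂ * o'.volumeForm (Fin.cons N₁ (A ∘ e)) := by
      have := o'.volumeForm.curryLeft.map_smul (inner ℝ N₁ N₂) N₁
      rw [← hexp] at this
      exact congrArg (fun η ↦ η (A ∘ e)) this
    rw [← h₁, ← h₂] at hval
    have hne : o.volumeForm e ≠ 0 := fun h ↦ by simp [h] at ho
    have h1 : inner ℝ N₁ N₂ = 1 := by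
      have : (inner ℝ N₁ N₂ - 1) * o.volumeForm e = 0 := by rw [sub_mul, ← hval]; ring
      rcases mul_eq_zero.1 this with h | h
      · linarith
      · exact absurd h hne
    rw [h1, one_smul] at hexp
    exact hexp.symm

/-! ### The unit normal as a normalized dual vector -/

/-- A positive definite bilinear form on a finite-dimensional space is nondegenerate. -/
lemma isInvertible_of_posDef {W : Type*} [NormedAddCommGroup W] [NormedSpace ℝ W]
    [FiniteDimensional ℝ W] (G : W →L[ℝ] W →L[ℝ] ℝ) (hG : ∀ v ≠ 0, 0 < G v v) :
    G.IsInvertible := by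
  have hinj : Function.Injective G.toLinearMap := by
    refine (injective_iff_map_eq_zero G.toLinearMap).2 fun v hv ↦ ?_
    by_contra h0
    have hv' : G v = 0 := hv
    simpa [hv'] using hG v h0
  have hdim : Module.finrank ℝ W = Module.finrank ℝ (W →L[ℝ] ℝ) := by
    rw [← LinearEquiv.finrank_eq (LinearMap.toContinuousLinearMap (𝕜 := ℝ) (E := W) (F' := ℝ))]
    exact (Subspace.dual_finrank_eq (K := ℝ) (V := W)).symm
  exact ⟨(LinearEquiv.ofInjectiveOfFinrankEq G.toLinearMap hinj hdim).toContinuousLinearEquiv,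
    by ext; rfl⟩

/-- A vector `N` that has length `1` for the inner product `G` and is `G`-orthogonal to the vectors
`w i` is, up to the sign of `s`, the normalization of the vector `G⁻¹ α`, where `α` is the linear
form `v ↦ det (v, w₁, …, wₙ)`: both `G N` and `α` vanish on the `w i`, hence are proportional. -/
lemma eq_smul_normalized_inverse {n : ℕ} {W : Type*} [NormedAddCommGroup W] [NormedSpace ℝ W]
    (b : Module.Basis (Fin (n + 1)) ℝ W) {G : W →L[ℝ] W →L[ℝ] ℝ} (hG : G.IsInvertible)
    (α : W →L[ℝ] ℝ) (w : Fin n → W) (hα : ∀ v, α v = b.det (Fin.cons v w)) {N : W}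
    (hN : G N N = 1) (hNw : ∀ i, G N (w i) = 0) {s : ℝ} (hs : 0 < s * α N) :
    N = (SignType.sign s : ℝ) • (√(G (G.inverse α) (G.inverse α)))⁻¹ • G.inverse α := by
  obtain ⟨G, rfl⟩ := hG
  have hinv : (G : W →L[ℝ] W →L[ℝ] ℝ).inverse α = G.symm α := by
    rw [ContinuousLinearMap.inverse_equiv]
    rfl
  rw [ContinuousLinearEquiv.coe_coe] at hN hNw
  have hα0 : α N ≠ 0 := fun h ↦ by simp [h] at hs
  have hαN : α = α N • G N := by
    -- `N` and the `w i` form a basis, on which both sides are compared.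
    have hdet : IsUnit (b.det (Fin.cons N w)) := by rw [← hα]; exact hα0.isUnit
    obtain ⟨hli, hspan⟩ := b.is_basis_iff_det.2 hdet
    refine ContinuousLinearMap.coe_injective ((Module.Basis.mk hli hspan.ge).ext fun i ↦ ?_)
    rw [Module.Basis.mk_apply]
    induction i using Fin.cases with
    | zero => simp [hN]
    | succ i =>
      have : α (w i) = 0 := by
        rw [hα]
        exact b.det.map_eq_zero_of_eq _ (i := 0) (j := i.succ) (by simp) (Fin.succ_ne_zero i).symm
      simp [hNw, this]
  have hsymm : G.symm α = α N • N := by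
    rw [hαN, map_smul, G.symm_apply_apply, ← hαN]
  have hval : G (α N • N) (α N • N) = α N ^ 2 := by
    simp [hN, sq]
  rw [hinv, hsymm, ContinuousLinearEquiv.coe_coe, hval, Real.sqrt_sq_eq_abs]
  rcases lt_trichotomy s 0 with h | h | h
  · have : α N < 0 := by nlinarith
    simp [sign_neg h, abs_of_neg this, inv_neg, smul_smul, inv_mul_cancel₀ hα0]
  · simp [h] at hs
  · have : 0 < α N := by nlinarith
    simp [sign_pos h, abs_of_pos this, smul_smul, inv_mul_cancel₀ hα0]

end LinearAlgebra

/-! ### Functions of locally constant sign -/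

section LocalSign

variable {X : Type*} [TopologicalSpace X] {f g h : X → ℝ} {p : X}

/-- Near `p` the function `f` has no zero and keeps the same sign, encoded as the sign of a real
number `s`. No continuity of `f` is required. -/
def HasConstantSignNear (f : X → ℝ) (p : X) : Prop :=
  ∃ s : ℝ, ∀ᶠ q in 𝓝 p, 0 < s * f q

lemma ContinuousAt.hasConstantSignNear (hf : ContinuousAt f p) (h0 : f p ≠ 0) :
    HasConstantSignNear f p :=
  ⟨f p, (continuousAt_const.mul hf).eventually_const_lt (mul_self_pos.2 h0)⟩

lemma HasConstantSignNear.mul_of_eventuallyEq (hg : HasConstantSignNear g p)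
    (hh : HasConstantSignNear h p) (hf : ∀ᶠ q in 𝓝 p, f q = g q * h q) :
    HasConstantSignNear f p := by
  obtain ⟨s, hs⟩ := hg
  obtain ⟨t, ht⟩ := hh
  refine ⟨s * t, ?_⟩
  filter_upwards [hs, ht, hf] with q h1 h2 h3
  rw [h3]
  nlinarith [mul_pos h1 h2]

lemma HasConstantSignNear.of_mul_eventuallyEq (hg : HasConstantSignNear g p)
    (hf : HasConstantSignNear f p) (hfgh : ∀ᶠ q in 𝓝 p, f q = g q * h q) :
    HasConstantSignNear h p := by
  obtain ⟨s, hs⟩ := hg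
  obtain ⟨t, ht⟩ := hf
  refine ⟨s * t, ?_⟩
  filter_upwards [hs, ht, hfgh] with q h1 h2 h3
  have h4 : 0 < (g q) ^ 2 := by
    have : g q ≠ 0 := fun h ↦ by simp [h] at h1
    positivity
  have h5 : 0 < (s * t * h q) * (g q) ^ 2 := by
    have := mul_pos h1 h2
    rw [h3] at this
    nlinarith
  exact pos_of_mul_pos_left h5 h4.le

lemma HasConstantSignNear.comp {Y : Type*} [TopologicalSpace Y] {φ : Y → X} {y : Y}
    (hf : HasConstantSignNear f (φ y)) (hφ : ContinuousAt φ y) :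
    HasConstantSignNear (f ∘ φ) y :=
  hf.imp fun _ hs ↦ hφ.eventually hs

end LocalSign

/-! ### Orientations in coordinates -/

noncomputable section

section Coordinates

variable {n : ℕ} {M : Type*} [TopologicalSpace M] [ChartedSpace (EuclideanSpace ℝ (Fin n)) M]
  [IsManifold (𝓡 n) ∞ M]

/-- The coordinate vectors at `q` of the preferred chart at `p`. Only meaningful for `q` in the
domain of that chart; the value is zero elsewhere. -/
def coordFrame (p q : M) (i : Fin n) : TangentSpace (𝓡 n) q :=
  (trivializationAt (EuclideanSpace ℝ (Fin n)) (TangentSpace (𝓡 n) : M → Type _) p).symmL ℝ q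
    (EuclideanSpace.basisFun (Fin n) ℝ i)

/-- The coordinate vectors of the preferred chart at `p`, as a basis of the tangent space at a
point `q` of the domain of that chart. -/
def coordBasis (p q : M) (hq : q ∈ (trivializationAt (EuclideanSpace ℝ (Fin n))
    (TangentSpace (𝓡 n) : M → Type _) p).baseSet) :
    Module.Basis (Fin n) ℝ (TangentSpace (𝓡 n) q) :=
  (EuclideanSpace.basisFun (Fin n) ℝ).toBasis.map
    ((trivializationAt (EuclideanSpace ℝ (Fin n))
      (TangentSpace (𝓡 n) : M → Type _) p).linearEquivAt ℝ q hq).symm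

lemma coe_coordBasis (p q : M) (hq : q ∈ (trivializationAt (EuclideanSpace ℝ (Fin n))
    (TangentSpace (𝓡 n) : M → Type _) p).baseSet) :
    ⇑(coordBasis p q hq) = coordFrame p q := by
  ext1 i
  simp only [coordBasis, coordFrame, Module.Basis.map_apply, OrthonormalBasis.coe_toBasis]
  exact (Bundle.Trivialization.symmL_apply (R := ℝ) _ hq _).symm

/-- A top-degree form on a tangent space, read in the coordinates of the preferred chart
at `p`. -/
lemma apply_eq_coordFrame_mul_det (p q : M) (hq : q ∈ (trivializationAt (EuclideanSpace ℝ (Fin n))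
    (TangentSpace (𝓡 n) : M → Type _) p).baseSet)
    (η : TangentSpace (𝓡 n) q [⋀^Fin n]→ₗ[ℝ] ℝ) (w : Fin n → TangentSpace (𝓡 n) q) :
    η w = η (coordFrame p q) * (EuclideanSpace.basisFun (Fin n) ℝ).toBasis.det
      fun i ↦ (trivializationAt (EuclideanSpace ℝ (Fin n))
        (TangentSpace (𝓡 n) : M → Type _) p).continuousLinearMapAt ℝ q (w i) := by
  conv_lhs => rw [η.eq_smul_basis_det (coordBasis p q hq)]
  rw [AlternatingMap.smul_apply, smul_eq_mul, coe_coordBasis, coordBasis, Module.Basis.det_map]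
  congr 2
  ext1 i
  simp [Bundle.Trivialization.continuousLinearMapAt_apply,
    Bundle.Trivialization.coe_linearMapAt_of_mem _ hq]

/-- The volume form of a single tangent space with inner product `g` and orientation `o`. -/
def tangentVolumeForm (g : Bundle.RiemannianMetric (TangentSpace (𝓡 n) : M → Type _)) (p : M)
    (o : Orientation ℝ (TangentSpace (𝓡 n) p) (Fin n)) :
    TangentSpace (𝓡 n) p [⋀^Fin n]→ₗ[ℝ] ℝ :=
  letI : Bundle.RiemannianBundle (TangentSpace (𝓡 n) : M → Type _) := ⟨g⟩
  haveI : Fact (Module.finrank ℝ (TangentSpace (𝓡 n) p) = n) :=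
    ⟨finrank_euclideanSpace_fin (𝕜 := ℝ) (n := n)⟩
  o.volumeForm

lemma riemannianVolumeForm_eq_tangentVolumeForm
    (g : Bundle.RiemannianMetric (TangentSpace (𝓡 n) : M → Type _))
    (O : ManifoldOrientation n M) (p : M) :
    riemannianVolumeForm g O p = tangentVolumeForm g p (O.at_ p) := rfl

lemma tangentVolumeForm_coordFrame_pos_iff
    (g : Bundle.RiemannianMetric (TangentSpace (𝓡 n) : M → Type _)) (p q : M)
    (hq : q ∈ (trivializationAt (EuclideanSpace ℝ (Fin n))
      (TangentSpace (𝓡 n) : M → Type _) p).baseSet)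
    (o : Orientation ℝ (TangentSpace (𝓡 n) q) (Fin n)) :
    0 < tangentVolumeForm g q o (coordFrame p q) ↔
      Orientation.map (Fin n) ((trivializationAt (EuclideanSpace ℝ (Fin n))
        (TangentSpace (𝓡 n) : M → Type _) p).linearEquivAt ℝ q hq) o =
      (EuclideanSpace.basisFun (Fin n) ℝ).toBasis.orientation := by
  let : Bundle.RiemannianBundle (TangentSpace (𝓡 n) : M → Type _) := ⟨g⟩
  have : Fact (Module.finrank ℝ (TangentSpace (𝓡 n) q) = n) :=
    ⟨finrank_euclideanSpace_fin (𝕜 := ℝ) (n := n)⟩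
  have : FiniteDimensional ℝ (TangentSpace (𝓡 n) q) :=
    inferInstanceAs (FiniteDimensional ℝ (EuclideanSpace ℝ (Fin n)))
  have h := volumeForm_basis_pos_iff o (coordBasis p q hq)
  rw [coe_coordBasis] at h
  refine h.trans ?_
  rw [coordBasis, Module.Basis.orientation_map, ← Orientation.map_symm, Equiv.symm_apply_eq,
    eq_comm]

lemma tangentVolumeForm_coordFrame_ne_zero
    (g : Bundle.RiemannianMetric (TangentSpace (𝓡 n) : M → Type _)) (p q : M)
    (hq : q ∈ (trivializationAt (EuclideanSpace ℝ (Fin n))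
      (TangentSpace (𝓡 n) : M → Type _) p).baseSet)
    (o : Orientation ℝ (TangentSpace (𝓡 n) q) (Fin n)) :
    tangentVolumeForm g q o (coordFrame p q) ≠ 0 := by
  let : Bundle.RiemannianBundle (TangentSpace (𝓡 n) : M → Type _) := ⟨g⟩
  have : Fact (Module.finrank ℝ (TangentSpace (𝓡 n) q) = n) :=
    ⟨finrank_euclideanSpace_fin (𝕜 := ℝ) (n := n)⟩
  have : FiniteDimensional ℝ (TangentSpace (𝓡 n) q) :=
    inferInstanceAs (FiniteDimensional ℝ (EuclideanSpace ℝ (Fin n)))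
  have h := volumeForm_basis_ne_zero o (coordBasis p q hq)
  rwa [coe_coordBasis] at h

/-- Orientations of the tangent spaces are locally constant in coordinates exactly when the volume
forms they define have locally constant sign on the coordinate frames. -/
lemma locallyConstant_orientation_iff_hasConstantSignNear
    (g : Bundle.RiemannianMetric (TangentSpace (𝓡 n) : M → Type _))
    (a : ∀ p : M, Orientation ℝ (TangentSpace (𝓡 n) p) (Fin n)) (p : M) :
    (∃ o : Orientation ℝ (EuclideanSpace ℝ (Fin n)) (Fin n),
      ∀ᶠ q in 𝓝 p, ∀ hq : q ∈ (trivializationAt (EuclideanSpace ℝ (Fin n))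
          (TangentSpace (𝓡 n) : M → Type _) p).baseSet,
        Orientation.map (Fin n) ((trivializationAt (EuclideanSpace ℝ (Fin n))
          (TangentSpace (𝓡 n) : M → Type _) p).linearEquivAt ℝ q hq) (a q) = o) ↔
    HasConstantSignNear (fun q ↦ tangentVolumeForm g q (a q) (coordFrame p q)) p := by
  have hbase := (trivializationAt (EuclideanSpace ℝ (Fin n))
    (TangentSpace (𝓡 n) : M → Type _) p).open_baseSet.mem_nhds
      (FiberBundle.mem_baseSet_trivializationAt' p)
  set o₀ := (EuclideanSpace.basisFun (Fin n) ℝ).toBasis.orientation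
  constructor
  · rintro ⟨o, ho⟩
    by_cases h : o = o₀
    · refine ⟨1, ?_⟩
      filter_upwards [ho, hbase] with q h1 hq
      rw [one_mul, tangentVolumeForm_coordFrame_pos_iff g p q hq, h1 hq, h]
    · refine ⟨-1, ?_⟩
      filter_upwards [ho, hbase] with q h1 hq
      rw [neg_one_mul, neg_pos]
      refine lt_of_le_of_ne (not_lt.1 ?_) (tangentVolumeForm_coordFrame_ne_zero g p q hq _)
      rwa [tangentVolumeForm_coordFrame_pos_iff g p q hq, h1 hq]
  · rintro ⟨s, hs⟩
    rcases le_total 0 s with h | h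
    · refine ⟨o₀, ?_⟩
      filter_upwards [hs] with q h1 hq
      rw [← tangentVolumeForm_coordFrame_pos_iff g p q hq]
      exact pos_of_mul_pos_right h1 h
    · refine ⟨-o₀, ?_⟩
      filter_upwards [hs] with q h1 hq
      rw [← Module.Basis.orientation_ne_iff_eq_neg, Ne,
        ← tangentVolumeForm_coordFrame_pos_iff g p q hq]
      nlinarith

end Coordinates

end

/-! ### The metric in coordinates -/

noncomputable section

lemma continuous_det_basisFun (m : ℕ) :
    Continuous fun w : Fin m → EuclideanSpace ℝ (Fin m) ↦
      (EuclideanSpace.basisFun (Fin m) ℝ).toBasis.det w := by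
  simp only [Module.Basis.det_apply]
  refine Continuous.matrix_det (continuous_matrix fun i j ↦ ?_)
  simp only [Module.Basis.toMatrix_apply, OrthonormalBasis.coe_toBasis_repr_apply,
    EuclideanSpace.basisFun_repr]
  fun_prop

section MetricInCoordinates

variable {n : ℕ} {M : Type*} [TopologicalSpace M] [ChartedSpace (EuclideanSpace ℝ (Fin n)) M]
  [IsManifold (𝓡 n) ∞ M]

/-- The inner product on the tangent space at `q`, read in the coordinates of the preferred chart
at `p`. -/
def metricInCoordinates (g : Bundle.ContMDiffRiemannianMetric (𝓡 n) ∞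
      (EuclideanSpace ℝ (Fin n)) (TangentSpace (𝓡 n) : M → Type _)) (p q : M) :
    EuclideanSpace ℝ (Fin n) →L[ℝ] EuclideanSpace ℝ (Fin n) →L[ℝ] ℝ :=
  ContinuousLinearMap.inCoordinates (EuclideanSpace ℝ (Fin n)) (TangentSpace (𝓡 n) : M → Type _)
    (EuclideanSpace ℝ (Fin n) →L[ℝ] ℝ) (fun x : M ↦ TangentSpace (𝓡 n) x →L[ℝ] ℝ) p q p q
    (g.inner q)

lemma continuousAt_metricInCoordinates (g : Bundle.ContMDiffRiemannianMetric (𝓡 n) ∞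
      (EuclideanSpace ℝ (Fin n)) (TangentSpace (𝓡 n) : M → Type _)) (p : M) :
    ContinuousAt (metricInCoordinates g p) p := by
  have h := g.contMDiff.continuous.continuousAt (x := p)
  rw [continuousAt_hom_bundle] at h
  exact h.2

lemma metricInCoordinates_apply (g : Bundle.ContMDiffRiemannianMetric (𝓡 n) ∞
      (EuclideanSpace ℝ (Fin n)) (TangentSpace (𝓡 n) : M → Type _)) (p q : M)
    (hq : q ∈ (trivializationAt (EuclideanSpace ℝ (Fin n))
      (TangentSpace (𝓡 n) : M → Type _) p).baseSet) (v w : EuclideanSpace ℝ (Fin n)) :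
    metricInCoordinates g p q v w = g.inner q
      ((trivializationAt (EuclideanSpace ℝ (Fin n))
        (TangentSpace (𝓡 n) : M → Type _) p).symmL ℝ q v)
      ((trivializationAt (EuclideanSpace ℝ (Fin n))
        (TangentSpace (𝓡 n) : M → Type _) p).symmL ℝ q w) := by
  rw [metricInCoordinates, inCoordinates_apply_eq₂ hq hq (Set.mem_univ _)]
  simp only [Bundle.Trivialization.symmL_apply (R := ℝ) _ hq]
  simp

lemma metricInCoordinates_continuousLinearMapAt (g : Bundle.ContMDiffRiemannianMetric (𝓡 n) ∞
      (EuclideanSpace ℝ (Fin n)) (TangentSpace (𝓡 n) : M → Type _)) (p q : M)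
    (hq : q ∈ (trivializationAt (EuclideanSpace ℝ (Fin n))
      (TangentSpace (𝓡 n) : M → Type _) p).baseSet) (v w : TangentSpace (𝓡 n) q) :
    metricInCoordinates g p q
      ((trivializationAt (EuclideanSpace ℝ (Fin n))
        (TangentSpace (𝓡 n) : M → Type _) p).continuousLinearMapAt ℝ q v)
      ((trivializationAt (EuclideanSpace ℝ (Fin n))
        (TangentSpace (𝓡 n) : M → Type _) p).continuousLinearMapAt ℝ q w) = g.inner q v w := by
  rw [metricInCoordinates_apply g p q hq,
    Bundle.Trivialization.symmL_continuousLinearMapAt _ hq,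
    Bundle.Trivialization.symmL_continuousLinearMapAt _ hq]

lemma isInvertible_metricInCoordinates (g : Bundle.ContMDiffRiemannianMetric (𝓡 n) ∞
      (EuclideanSpace ℝ (Fin n)) (TangentSpace (𝓡 n) : M → Type _)) (p q : M)
    (hq : q ∈ (trivializationAt (EuclideanSpace ℝ (Fin n))
      (TangentSpace (𝓡 n) : M → Type _) p).baseSet) :
    (metricInCoordinates g p q).IsInvertible := by
  refine isInvertible_of_posDef _ fun v hv ↦ ?_
  rw [metricInCoordinates_apply g p q hq]
  refine g.pos q _ fun h ↦ hv ?_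
  rw [← Bundle.Trivialization.continuousLinearMapAt_symmL (R := ℝ) _ hq v, h, map_zero]

end MetricInCoordinates

/-! ### Normal fields along a hypersurface -/

section Hypersurface

variable {n : ℕ}
  {M : Type*} [TopologicalSpace M] [ChartedSpace (EuclideanSpace ℝ (Fin n)) M]
  {M' : Type*} [TopologicalSpace M'] [ChartedSpace (EuclideanSpace ℝ (Fin (n + 1))) M']
  [IsManifold (𝓡 n) ∞ M] [IsManifold (𝓡 (n + 1)) ∞ M']

/-- The images under `dι` of the coordinate vectors of the preferred chart at `p`, read in the
coordinates of the preferred chart at `ι p`. -/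
def tangentFrameInCoordinates (ι : M → M') (p q : M) (i : Fin n) : EuclideanSpace ℝ (Fin (n + 1)) :=
  (trivializationAt (EuclideanSpace ℝ (Fin (n + 1)))
    (TangentSpace (𝓡 (n + 1)) : M' → Type _) (ι p)).continuousLinearMapAt ℝ (ι q)
      (mfderiv (𝓡 n) (𝓡 (n + 1)) ι q (coordFrame p q i))

lemma continuousAt_tangentFrameInCoordinates {ι : M → M'} (hι : ContMDiff (𝓡 n) (𝓡 (n + 1)) ∞ ι)
    (p : M) : ContinuousAt (tangentFrameInCoordinates (n := n) ι p) p := by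
  have h := (hι.contMDiffAt (x := p)).mfderiv_const (m := 0) (by simp)
  exact continuousAt_pi.2 fun i ↦ (h.continuousAt.clm_apply continuousAt_const)

/-- The determinant of `(N, dι e₁, …, dι eₙ)` in coordinates around `p` and `ι p`. -/
def normalDet (ι : M → M') (N : ∀ p : M, TangentSpace (𝓡 (n + 1)) (ι p)) (p q : M) : ℝ :=
  (EuclideanSpace.basisFun (Fin (n + 1)) ℝ).toBasis.det
    (Fin.cons ((trivializationAt (EuclideanSpace ℝ (Fin (n + 1)))
      (TangentSpace (𝓡 (n + 1)) : M' → Type _) (ι p)).continuousLinearMapAt ℝ (ι q) (N q))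
      (tangentFrameInCoordinates ι p q))

lemma interiorRestrict_coordFrame (ι : M → M') (N : ∀ p : M, TangentSpace (𝓡 (n + 1)) (ι p))
    (η : ∀ y : M', TangentSpace (𝓡 (n + 1)) y [⋀^Fin (n + 1)]→ₗ[ℝ] ℝ) (p q : M)
    (hq : ι q ∈ (trivializationAt (EuclideanSpace ℝ (Fin (n + 1)))
      (TangentSpace (𝓡 (n + 1)) : M' → Type _) (ι p)).baseSet) :
    interiorRestrict ι N η q (coordFrame p q) =
      η (ι q) (coordFrame (ι p) (ι q)) * normalDet ι N p q := by
  have h : interiorRestrict ι N η q (coordFrame p q) = η (ι q)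
      (Fin.cons (N q) fun i ↦ mfderiv (𝓡 n) (𝓡 (n + 1)) ι q (coordFrame p q i)) := rfl
  rw [h, apply_eq_coordFrame_mul_det (ι p) (ι q) hq, normalDet]
  congr 2
  ext1 i
  induction i using Fin.cases <;> rfl

omit [ChartedSpace (EuclideanSpace ℝ (Fin n)) M] [IsManifold (𝓡 n) ∞ M] in
lemma eventually_mem_baseSet {ι : M → M'} (hι : Continuous ι) (p : M) :
    ∀ᶠ q in 𝓝 p, ι q ∈ (trivializationAt (EuclideanSpace ℝ (Fin (n + 1)))
      (TangentSpace (𝓡 (n + 1)) : M' → Type _) (ι p)).baseSet :=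
  hι.continuousAt.eventually_mem ((trivializationAt (EuclideanSpace ℝ (Fin (n + 1)))
    (TangentSpace (𝓡 (n + 1)) : M' → Type _) (ι p)).open_baseSet.mem_nhds
      (FiberBundle.mem_baseSet_trivializationAt' (ι p)))

omit [ChartedSpace (EuclideanSpace ℝ (Fin n)) M] [IsManifold (𝓡 n) ∞ M] in
/-- Continuity of a vector field along a map, read in coordinates. -/
lemma continuousAt_along_iff {ι : M → M'} (hι : Continuous ι)
    (N : ∀ p : M, TangentSpace (𝓡 (n + 1)) (ι p)) (p : M) :
    ContinuousAt (fun q : M ↦ (⟨ι q, N q⟩ : TangentBundle (𝓡 (n + 1)) M')) p ↔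
      ContinuousAt (fun q ↦ (trivializationAt (EuclideanSpace ℝ (Fin (n + 1)))
        (TangentSpace (𝓡 (n + 1)) : M' → Type _) (ι p)).continuousLinearMapAt ℝ (ι q) (N q)) p := by
  refine (FiberBundle.continuousAt_totalSpace (EuclideanSpace ℝ (Fin (n + 1))) _).trans ?_
  refine (and_iff_right hι.continuousAt).trans (continuousAt_congr ?_)
  filter_upwards [eventually_mem_baseSet (n := n) hι p] with q hq
  rw [Bundle.Trivialization.continuousLinearMapAt_apply,
    Bundle.Trivialization.coe_linearMapAt_of_mem _ hq]

lemma continuousAt_normalDet {ι : M → M'} (hι : ContMDiff (𝓡 n) (𝓡 (n + 1)) ∞ ι)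
    (N : ∀ p : M, TangentSpace (𝓡 (n + 1)) (ι p)) (p : M)
    (hN : ContinuousAt (fun q : M ↦ (⟨ι q, N q⟩ : TangentBundle (𝓡 (n + 1)) M')) p) :
    ContinuousAt (normalDet ι N p) p := by
  refine (continuous_det_basisFun (n + 1)).continuousAt.comp (continuousAt_pi.2 fun i ↦ ?_)
  induction i using Fin.cases with
  | zero => exact (continuousAt_along_iff hι.continuous N p).1 hN
  | succ i => exact continuousAt_pi.1 (continuousAt_tangentFrameInCoordinates (n := n) hι p) i

/-- The linear form `v ↦ det (v, w₁, …, wₙ)`. -/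
def detConormal (w : Fin n → EuclideanSpace ℝ (Fin (n + 1))) :
    EuclideanSpace ℝ (Fin (n + 1)) →L[ℝ] ℝ :=
  LinearMap.toContinuousLinearMap
    { toFun := fun v ↦ (EuclideanSpace.basisFun (Fin (n + 1)) ℝ).toBasis.det (Fin.cons v w)
      map_add' := fun v v' ↦ congrArg (fun η ↦ η w)
        ((EuclideanSpace.basisFun (Fin (n + 1)) ℝ).toBasis.det.curryLeft.map_add v v')
      map_smul' := fun c v ↦ congrArg (fun η ↦ η w)
        ((EuclideanSpace.basisFun (Fin (n + 1)) ℝ).toBasis.det.curryLeft.map_smul c v) }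

lemma continuous_detConormal : Continuous (detConormal (n := n)) := by
  refine continuous_clm_apply.2 fun v ↦ (continuous_det_basisFun (n + 1)).comp ?_
  refine continuous_pi fun i ↦ ?_
  induction i using Fin.cases with
  | zero => exact continuous_const
  | succ i => exact continuous_apply i

/-- A unit normal field is continuous as soon as it stays on one side of the hypersurface: near `p`
it is then given by the formula of `eq_smul_normalized_inverse` with a constant sign, and the
ingredients of that formula are continuous. -/
lemma continuousAt_unitNormal (g' : Bundle.ContMDiffRiemannianMetric (𝓡 (n + 1)) ∞
      (EuclideanSpace ℝ (Fin (n + 1))) (TangentSpace (𝓡 (n + 1)) : M' → Type _))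
    {ι : M → M'} (hι : ContMDiff (𝓡 n) (𝓡 (n + 1)) ∞ ι)
    (N : ∀ p : M, TangentSpace (𝓡 (n + 1)) (ι p))
    (hnormal : ∀ (p : M) (v : TangentSpace (𝓡 n) p),
      g'.inner (ι p) (N p) (mfderiv (𝓡 n) (𝓡 (n + 1)) ι p v) = 0)
    (hunit : ∀ p, g'.inner (ι p) (N p) (N p) = 1) (p : M)
    (hsign : HasConstantSignNear (normalDet ι N p) p) :
    ContinuousAt (fun q : M ↦ (⟨ι q, N q⟩ : TangentBundle (𝓡 (n + 1)) M')) p := by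
  rw [continuousAt_along_iff hι.continuous]
  obtain ⟨s, hs⟩ := hsign
  let G : M → _ := fun q ↦ metricInCoordinates g' (ι p) (ι q)
  let α : M → _ := fun q ↦ detConormal (tangentFrameInCoordinates (n := n) ι p q)
  have hG : ContinuousAt G p :=
    (continuousAt_metricInCoordinates g' (ι p)).comp hι.continuous.continuousAt
  have hα : ContinuousAt α p :=
    continuous_detConormal.continuousAt.comp (continuousAt_tangentFrameInCoordinates (n := n) hι p)
  have hGp : (G p).IsInvertible :=
    isInvertible_metricInCoordinates g' _ _ (FiberBundle.mem_baseSet_trivializationAt' (ι p))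
  let ν : M → _ := fun q ↦ (G q).inverse (α q)
  have hν : ContinuousAt ν p :=
    (ContinuousAt.comp (g := ContinuousLinearMap.inverse)
      (hGp.contDiffAt_map_inverse (n := 0)).continuousAt hG).clm_apply hα
  have hαp : α p ≠ 0 := by
    intro h
    -- `normalDet ι N p p` is the value of `α p` on `N p`.
    have h1 : s * α p _ > 0 := hs.self_of_nhds
    rw [h] at h1
    simp at h1
  have hνp : 0 < G p (ν p) (ν p) := by
    have h0 : ν p ≠ 0 := by
      intro h
      obtain ⟨G₀, hG₀⟩ := hGp
      simp only [ν, ← hG₀, ContinuousLinearMap.inverse_equiv] at h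
      exact hαp (G₀.symm.map_eq_zero_iff.1 h)
    have hb := FiberBundle.mem_baseSet_trivializationAt' (F := EuclideanSpace ℝ (Fin (n + 1)))
      (E := (TangentSpace (𝓡 (n + 1)) : M' → Type _)) (ι p)
    simp only [G]
    rw [metricInCoordinates_apply g' _ _ hb]
    refine g'.pos _ _ fun h ↦ h0 ?_
    rw [← Bundle.Trivialization.continuousLinearMapAt_symmL (R := ℝ) _ hb (ν p), h, map_zero]
  have hnorm : ContinuousAt (fun q ↦ (√(G q (ν q) (ν q)))⁻¹) p :=
    ((hG.clm_apply hν).clm_apply hν).sqrt.inv₀ (Real.sqrt_ne_zero'.2 hνp)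
  have hunitν : ContinuousAt (fun q ↦ (√(G q (ν q) (ν q)))⁻¹ • ν q) p := hnorm.smul hν
  have hformula : ContinuousAt
      (fun q ↦ (SignType.sign s : ℝ) • (√(G q (ν q) (ν q)))⁻¹ • ν q) p :=
    hunitν.const_smul (SignType.sign s : ℝ)
  refine hformula.congr ?_
  filter_upwards [hs, eventually_mem_baseSet (n := n) hι.continuous p] with q hq hb
  refine (eq_smul_normalized_inverse (EuclideanSpace.basisFun (Fin (n + 1)) ℝ).toBasis
    (isInvertible_metricInCoordinates g' _ _ hb) (α q) (tangentFrameInCoordinates ι p q)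
    (fun v ↦ rfl) ?_ (fun i ↦ ?_) hq).symm
  · rw [metricInCoordinates_continuousLinearMapAt g' _ _ hb, hunit]
  · rw [tangentFrameInCoordinates, metricInCoordinates_continuousLinearMapAt g' _ _ hb, hnormal]

/-- For an orientation of the tangent spaces and a unit normal field that correspond to each other
through `dV_g = (N ⌟ dV_g')|_M`, local constancy of the one is equivalent to continuity of the
other: both say that `det (N, dι e₁, …, dι eₙ)` has locally constant sign in coordinates. -/
lemma hasConstantSignNear_iff_normalDet
    (g : Bundle.RiemannianMetric (TangentSpace (𝓡 n) : M → Type _))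
    (g' : Bundle.RiemannianMetric (TangentSpace (𝓡 (n + 1)) : M' → Type _))
    (O' : ManifoldOrientation (n + 1) M') {ι : M → M'} (hι : Continuous ι)
    (N : ∀ p : M, TangentSpace (𝓡 (n + 1)) (ι p))
    (a : ∀ p : M, Orientation ℝ (TangentSpace (𝓡 n) p) (Fin n))
    (ha : ∀ p, tangentVolumeForm g p (a p) =
      interiorRestrict ι N (riemannianVolumeForm g' O') p) (p : M) :
    HasConstantSignNear (fun q ↦ tangentVolumeForm g q (a q) (coordFrame p q)) p ↔
      HasConstantSignNear (normalDet ι N p) p := by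
  have h' : HasConstantSignNear
      (fun q ↦ riemannianVolumeForm g' O' (ι q) (coordFrame (ι p) (ι q))) p :=
    ((locallyConstant_orientation_iff_hasConstantSignNear g' O'.at_ (ι p)).1
      (O'.continuous' (ι p))).comp hι.continuousAt
  have hmul : ∀ᶠ q in 𝓝 p, tangentVolumeForm g q (a q) (coordFrame p q) =
      riemannianVolumeForm g' O' (ι q) (coordFrame (ι p) (ι q)) * normalDet ι N p q := by
    filter_upwards [eventually_mem_baseSet (n := n) hι p] with q hq
    rw [ha, interiorRestrict_coordFrame ι N _ p q hq]
  exact ⟨fun h ↦ h'.of_mul_eventuallyEq h hmul, fun h ↦ h'.mul_of_eventuallyEq h hmul⟩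

/-! ### Correspondence of orientations and unit normal fields -/

section Correspondence

variable (g' : Bundle.ContMDiffRiemannianMetric (𝓡 (n + 1)) ∞
      (EuclideanSpace ℝ (Fin (n + 1))) (TangentSpace (𝓡 (n + 1)) : M' → Type _))
  (O' : ManifoldOrientation (n + 1) M') {ι : M → M'}
  (hι : Manifold.IsSmoothEmbedding (𝓡 n) (𝓡 (n + 1)) ∞ ι)

omit [IsManifold (𝓡 n) ∞ M] in
lemma existsUnique_tangentOrientation (N : ∀ p : M, TangentSpace (𝓡 (n + 1)) (ι p)) (p : M)
    (hnormal : ∀ v : TangentSpace (𝓡 n) p,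
      g'.inner (ι p) (N p) (mfderiv (𝓡 n) (𝓡 (n + 1)) ι p v) = 0)
    (hunit : g'.inner (ι p) (N p) (N p) = 1) :
    ∃! o : Orientation ℝ (TangentSpace (𝓡 n) p) (Fin n),
      tangentVolumeForm (inducedMetric g' hι) p o =
        interiorRestrict ι N (riemannianVolumeForm g'.toRiemannianMetric O') p := by
  let : Bundle.RiemannianBundle (TangentSpace (𝓡 (n + 1)) : M' → Type _) :=
    ⟨g'.toRiemannianMetric⟩
  let : Bundle.RiemannianBundle (TangentSpace (𝓡 n) : M → Type _) := ⟨inducedMetric g' hι⟩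
  have : Fact (Module.finrank ℝ (TangentSpace (𝓡 n) p) = n) :=
    ⟨finrank_euclideanSpace_fin (𝕜 := ℝ) (n := n)⟩
  have : Fact (Module.finrank ℝ (TangentSpace (𝓡 (n + 1)) (ι p)) = n + 1) :=
    ⟨finrank_euclideanSpace_fin (𝕜 := ℝ) (n := n + 1)⟩
  have : FiniteDimensional ℝ (TangentSpace (𝓡 n) p) :=
    inferInstanceAs (FiniteDimensional ℝ (EuclideanSpace ℝ (Fin n)))
  let A : TangentSpace (𝓡 n) p →ₗᵢ[ℝ] TangentSpace (𝓡 (n + 1)) (ι p) :=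
    (mfderiv (𝓡 n) (𝓡 (n + 1)) ι p).toLinearMap.isometryOfInner fun _ _ ↦ rfl
  have hN : ‖N p‖ = 1 := by
    have h : inner ℝ (N p) (N p) = 1 := hunit
    rw [real_inner_self_eq_norm_sq] at h
    exact (pow_eq_one_iff_of_nonneg (norm_nonneg _) two_ne_zero).1 h
  exact existsUnique_orientation_of_normal A hN hnormal (O'.at_ (ι p))

omit [IsManifold (𝓡 n) ∞ M] in
lemma existsUnique_tangentNormal (p : M) (o : Orientation ℝ (TangentSpace (𝓡 n) p) (Fin n)) :
    ∃! v : TangentSpace (𝓡 (n + 1)) (ι p),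
      ((∀ w : TangentSpace (𝓡 n) p,
        g'.inner (ι p) v (mfderiv (𝓡 n) (𝓡 (n + 1)) ι p w) = 0) ∧ g'.inner (ι p) v v = 1) ∧
      tangentVolumeForm (inducedMetric g' hι) p o =
        ((riemannianVolumeForm g'.toRiemannianMetric O' (ι p)).curryLeft v).compLinearMap
          (mfderiv (𝓡 n) (𝓡 (n + 1)) ι p).toLinearMap := by
  let : Bundle.RiemannianBundle (TangentSpace (𝓡 (n + 1)) : M' → Type _) :=
    ⟨g'.toRiemannianMetric⟩
  let : Bundle.RiemannianBundle (TangentSpace (𝓡 n) : M → Type _) := ⟨inducedMetric g' hι⟩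
  have : Fact (Module.finrank ℝ (TangentSpace (𝓡 n) p) = n) :=
    ⟨finrank_euclideanSpace_fin (𝕜 := ℝ) (n := n)⟩
  have : Fact (Module.finrank ℝ (TangentSpace (𝓡 (n + 1)) (ι p)) = n + 1) :=
    ⟨finrank_euclideanSpace_fin (𝕜 := ℝ) (n := n + 1)⟩
  have : FiniteDimensional ℝ (TangentSpace (𝓡 n) p) :=
    inferInstanceAs (FiniteDimensional ℝ (EuclideanSpace ℝ (Fin n)))
  have : FiniteDimensional ℝ (TangentSpace (𝓡 (n + 1)) (ι p)) :=
    inferInstanceAs (FiniteDimensional ℝ (EuclideanSpace ℝ (Fin (n + 1))))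
  let A : TangentSpace (𝓡 n) p →ₗᵢ[ℝ] TangentSpace (𝓡 (n + 1)) (ι p) :=
    (mfderiv (𝓡 n) (𝓡 (n + 1)) ι p).toLinearMap.isometryOfInner fun _ _ ↦ rfl
  have hunit (v : TangentSpace (𝓡 (n + 1)) (ι p)) : g'.inner (ι p) v v = 1 ↔ ‖v‖ = 1 := by
    change inner ℝ v v = 1 ↔ _
    rw [real_inner_self_eq_norm_sq]
    exact pow_eq_one_iff_of_nonneg (norm_nonneg _) two_ne_zero
  simp only [hunit]
  exact existsUnique_normal_of_orientation A o (O'.at_ (ι p))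

/-- The orientation induced by a continuous unit normal field is continuous. -/
lemma existsUnique_orientation_of_isContinuousUnitNormal
    (N : ∀ p : M, TangentSpace (𝓡 (n + 1)) (ι p)) (hN : IsContinuousUnitNormal g' ι N) :
    ∃! O : ManifoldOrientation n M, riemannianVolumeForm (inducedMetric g' hι) O =
      interiorRestrict ι N (riemannianVolumeForm g'.toRiemannianMetric O') := by
  have hex (p : M) := existsUnique_tangentOrientation g' O' hι N p (hN.normal p) (hN.unit p)
  choose a ha hauniq using hex
  refine ⟨⟨a, fun p ↦ ?_⟩, funext ha, fun O hO ↦ ?_⟩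
  · rw [locallyConstant_orientation_iff_hasConstantSignNear (inducedMetric g' hι) a p,
      hasConstantSignNear_iff_normalDet _ g'.toRiemannianMetric O' hι.contMDiff.continuous N a ha]
    refine (continuousAt_normalDet hι.contMDiff N p hN.continuous.continuousAt
      ).hasConstantSignNear fun h0 ↦ ?_
    have h1 := interiorRestrict_coordFrame ι N
      (riemannianVolumeForm g'.toRiemannianMetric O') p p
      (FiberBundle.mem_baseSet_trivializationAt' (ι p))
    rw [h0, mul_zero] at h1
    exact tangentVolumeForm_coordFrame_ne_zero _ p p
      (FiberBundle.mem_baseSet_trivializationAt' p) (a p) (by rw [ha, h1])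
  · ext1
    exact funext fun p ↦ hauniq p _ (congrFun hO p)

/-- The unit normal field determined by an orientation is continuous. -/
lemma existsUnique_isContinuousUnitNormal_of_orientation (O : ManifoldOrientation n M) :
    ∃! N : ∀ p : M, TangentSpace (𝓡 (n + 1)) (ι p), IsContinuousUnitNormal g' ι N ∧
      riemannianVolumeForm (inducedMetric g' hι) O =
        interiorRestrict ι N (riemannianVolumeForm g'.toRiemannianMetric O') := by
  have hex (p : M) := existsUnique_tangentNormal g' O' hι p (O.at_ p)
  choose N hN hNuniq using hex
  refine ⟨N, ⟨⟨fun p ↦ (hN p).1.1, fun p ↦ (hN p).1.2, ?_⟩, funext fun p ↦ (hN p).2⟩,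
    fun N₁ h ↦ funext fun p ↦ hNuniq p _ ⟨⟨h.1.normal p, h.1.unit p⟩, congrFun h.2 p⟩⟩
  refine continuous_iff_continuousAt.2 fun p ↦ continuousAt_unitNormal g' hι.contMDiff N
    (fun p ↦ (hN p).1.1) (fun p ↦ (hN p).1.2) p ?_
  rw [← hasConstantSignNear_iff_normalDet (inducedMetric g' hι) g'.toRiemannianMetric O'
    hι.contMDiff.continuous N O.at_ fun p ↦ (hN p).2]
  exact (locallyConstant_orientation_iff_hasConstantSignNear _ O.at_ p).1 (O.continuous' p)

end Correspondence

end Hypersurface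

end

theorem mainTheorem11 (n : ℕ)
    {M' : Type*} [TopologicalSpace M'] [ChartedSpace (EuclideanSpace ℝ (Fin (n + 1))) M']
    [IsManifold (𝓡 (n + 1)) ∞ M']
    (g' : Bundle.ContMDiffRiemannianMetric (𝓡 (n + 1)) ∞
      (EuclideanSpace ℝ (Fin (n + 1))) (TangentSpace (𝓡 (n + 1)) : M' → Type _))
    (O' : ManifoldOrientation (n + 1) M')
    {M : Type*} [TopologicalSpace M] [ChartedSpace (EuclideanSpace ℝ (Fin n)) M]
    [IsManifold (𝓡 n) ∞ M]
    (ι : M → M') (hι : Manifold.IsSmoothEmbedding (𝓡 n) (𝓡 (n + 1)) ∞ ι) :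
    (IsOrientable n M ↔
      ∃ N : ∀ p : M, TangentSpace (𝓡 (n + 1)) (ι p), IsContinuousUnitNormal g' ι N) ∧
    (∀ N : ∀ p : M, TangentSpace (𝓡 (n + 1)) (ι p), IsContinuousUnitNormal g' ι N →
      ∃! O : ManifoldOrientation n M,
        riemannianVolumeForm (inducedMetric g' hι) O =
          interiorRestrict ι N (riemannianVolumeForm g'.toRiemannianMetric O')) ∧
    (∀ O : ManifoldOrientation n M,
      ∃! N : ∀ p : M, TangentSpace (𝓡 (n + 1)) (ι p), IsContinuousUnitNormal g' ι N ∧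
        riemannianVolumeForm (inducedMetric g' hι) O =
          interiorRestrict ι N (riemannianVolumeForm g'.toRiemannianMetric O')) := by
  have h₁ := existsUnique_orientation_of_isContinuousUnitNormal g' O' hι
  have h₂ := existsUnique_isContinuousUnitNormal_of_orientation g' O' hι
  refine ⟨⟨fun ⟨O⟩ ↦ ?_, fun ⟨N, hN⟩ ↦ ?_⟩, h₁, h₂⟩
  · obtain ⟨N, hN, -⟩ := h₂ O
    exact ⟨N, hN.1⟩
  · obtain ⟨O, -, -⟩ := h₁ N hN
    exact ⟨O⟩
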